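/- Let $q > 13$ be a prime power and let $a$ be an integer with $0 \le a \le (q-10)/4$. Let $\mathcal{S}$ be a partial $(q+a)$-cover of $\mathrm{PG}(2,q)$, that is, a set of exactly $q+a$ distinct lines of the projective plane $\mathrm{PG}(2,q)$ over the field $\mathbb{F}_q$ such that at least one point of $\mathrm{PG}(2,q)$ lies on none of these lines. Let $\mathcal{H}_{\mathcal{S}}$ denote the set of holes of $\mathcal{S}$, i.e. the set of points of $\mathrm{PG}(2,q)$ that lie on no line of $\mathcal{S}$. If $|\mathcal{H}_{\mathcal{S}}| \le q+a$, then $|\mathcal{H}_{\mathcal{S}}| \le q$ and all points of $\mathcal{H}_{\mathcal{S}}$ lie on a common line. -/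

import Mathlib

open scoped LinearAlgebra.Projectivization

namespace PartialCover

/-- The projective space `PG(n, K)`: the one-dimensional subspaces of `K ^ (n + 1)`.
When `K` is a finite field with `q` elements this is `PG(n, q)`. -/
abbrev PG (n : ℕ) (K : Type*) [Field K] : Type _ :=
  ℙ K (Fin (n + 1) → K)

/-- A hyperplane of `PG(n, K)`: a projective subspace whose underlying linear subspace of
`K ^ (n + 1)` has dimension `n`. For `n = 2` these are the lines of the plane. -/
def IsHyperplane {n : ℕ} {K : Type*} [Field K]
    (H : Projectivization.Subspace K (Fin (n + 1) → K)) : Prop :=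
  Module.finrank K H.submodule = n

/-- The set of members of `S` that contain the point `P`. -/
def through {n : ℕ} {K : Type*} [Field K]
    (S : Set (Projectivization.Subspace K (Fin (n + 1) → K))) (P : PG n K) :
    Set (Projectivization.Subspace K (Fin (n + 1) → K)) :=
  {H ∈ S | P ∈ H}

/-- The holes of `S`: the points that lie on no member of `S`. -/
def holes {n : ℕ} {K : Type*} [Field K]
    (S : Set (Projectivization.Subspace K (Fin (n + 1) → K))) : Set (PG n K) :=
  {P | through S P = ∅}

/-- `S` is a partial `k`-cover of `PG(n, K)`: a set of exactly `k` hyperplanes that leaves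
at least one point uncovered. -/
structure IsPartialCover {n : ℕ} {K : Type*} [Field K] (k : ℕ)
    (S : Set (Projectivization.Subspace K (Fin (n + 1) → K))) : Prop where
  isHyperplane : ∀ H ∈ S, IsHyperplane H
  finite : S.Finite
  ncard_eq : S.ncard = k
  holes_nonempty : (holes S).Nonempty

end PartialCover

/-! Write q for `Nat.card K`. A polynomial argument shows that lines avoiding a point P and covering
all other points number more than 2(q - 1). Colour the holes other than P by their lines through P.
If no colour were frequent, these holes could be paired so that the line of each pair misses P;
adding these lines to `S` would cover everything but P with only 2(q - 1) lines. So each hole lies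
on a line with at least q - a holes. Two such lines share at most one hole, so 2(q - a) ≤ q + a + 1
if they differ, which is impossible: all holes lie on one line. That line meets a member of `S` in a
covered point, so at most q of its points are holes. -/

namespace PartialCover

/-! ### Polynomial method -/

open MvPolynomial in
/-- Finitely many subspaces of `K ^ σ` that avoid the vector `p` but cover every vector which is
not a multiple of `p` number more than `(|σ| - 1) (|K| - 1)`. -/
theorem lt_card_of_covers_off_span {K σ ι : Type*} [Field K] [Fintype K] [Fintype σ] [Fintype ι]
    [Nonempty ι] (W : ι → Submodule K (σ → K)) (p : σ → K) (hp : ∀ i, p ∉ W i)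
    (hW : ∀ x, x ∉ Submodule.span K {p} → ∃ i, x ∈ W i) :
    (Fintype.card σ - 1) * (Fintype.card K - 1) < Fintype.card ι := by
  classical
  by_contra! hlt
  have hf : ∀ i, ∃ f : Module.Dual K (σ → K), f p ≠ 0 ∧ ∀ x ∈ W i, f x = 0 := fun i => by
    obtain ⟨f, hfp, hfW⟩ := Submodule.exists_dual_map_eq_bot_of_notMem (hp i) inferInstance
    refine ⟨f, hfp, fun x hx => ?_⟩
    exact (Submodule.mem_bot K).1 (hfW ▸ Submodule.mem_map_of_mem hx)
  choose f hfp hfW using hf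
  obtain ⟨i₀⟩ := ‹Nonempty ι›
  have hp0 : p ≠ 0 := fun h => hfp i₀ (by simp [h])
  -- Padding by j factors makes the degree a positive multiple of |K| - 1, yet too small for the sum
  -- of F over all vectors to be nonzero. Only multiples of p contribute, and they sum to -F(p) ≠ 0.
  obtain ⟨j, hj⟩ := Nat.exists_eq_add_of_le hlt
  let lin : ι → MvPolynomial σ K := fun i => ∑ k, C (f i (Pi.single k 1)) * X k
  have eval_lin : ∀ i x, eval x (lin i) = f i x := fun i x => by
    conv_rhs => rw [LinearMap.pi_apply_eq_sum_univ (f i) x]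
    simp only [lin, map_sum, map_mul, eval_C, eval_X, smul_eq_mul]
    refine Finset.sum_congr rfl fun k _ => ?_
    rw [mul_comm]
    congr 2
    ext l
    simp [Pi.single_apply, eq_comm]
  have deg_lin : ∀ i, (lin i).totalDegree ≤ 1 := fun i => by
    refine (totalDegree_finsetSum_le fun k _ => (totalDegree_mul _ _).trans ?_)
    simp
  let F : MvPolynomial σ K := (∏ i, lin i) * lin i₀ ^ j
  have eval_F : ∀ x, eval x F = (∏ i, f i x) * f i₀ x ^ j := fun x => by
    simp [F, eval_lin, map_prod]
  have hcard : 1 < Fintype.card K := Fintype.one_lt_card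
  have hι : 0 < Fintype.card ι := Fintype.card_pos_iff.2 ⟨i₀⟩
  have hN : (Fintype.card σ - 1) * (Fintype.card K - 1) ≠ 0 := by omega
  have hσ : 1 < Fintype.card σ := by
    by_contra! h
    exact hN (by simp [Nat.sub_eq_zero_of_le h])
  have hdeg : F.totalDegree < (Fintype.card K - 1) * Fintype.card σ := by
    have h1 : F.totalDegree ≤ Fintype.card ι + j := by
      refine (totalDegree_mul _ _).trans (Nat.add_le_add ?_ ?_)
      · refine (totalDegree_finsetProd _ _).trans ((Finset.sum_le_sum fun i _ => deg_lin i).trans ?_)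
        simp
      · refine (totalDegree_pow _ _).trans ?_
        simpa using Nat.mul_le_mul_left j (deg_lin i₀)
    rw [← hj, mul_comm] at h1
    exact h1.trans_lt (Nat.mul_lt_mul_of_pos_left (by omega) (by omega))
  have hsum := MvPolynomial.sum_eval_eq_zero F hdeg
  have hinj : Function.Injective fun c : K => c • p := smul_left_injective K hp0
  have hline : ∑ x, eval x F = ∑ c : K, eval (c • p) F := by
    rw [← Finset.sum_image (f := fun x => eval x F) (s := Finset.univ) (g := fun c : K => c • p)
      (fun a _ b _ h => hinj h)]
    symm
    refine Finset.sum_subset (Finset.subset_univ _) fun x _ hx => ?_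
    obtain ⟨i, hi⟩ := hW x fun h => hx <| by
      obtain ⟨c, rfl⟩ := Submodule.mem_span_singleton.1 h
      simp
    rw [eval_F, Finset.prod_eq_zero (Finset.mem_univ i) (hfW i x hi), zero_mul]
  have hscale : ∀ c : K, eval (c • p) F
      = c ^ ((Fintype.card σ - 1) * (Fintype.card K - 1)) * eval p F := fun c => by
    rw [eval_F, eval_F, hj, pow_add]
    simp only [map_smul, smul_eq_mul, Finset.prod_mul_distrib, Finset.prod_const, mul_pow,
      Finset.card_univ]
    ring
  have hpow : ∀ c : K, c ^ ((Fintype.card σ - 1) * (Fintype.card K - 1)) = if c = 0 then 0 else 1 :=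
    fun c => by
      split_ifs with h
      · rw [h, zero_pow hN]
      · rw [mul_comm, pow_mul, FiniteField.pow_card_sub_one_eq_one c h, one_pow]
  have hcount : ∑ c : K, (if c = 0 then (0 : K) else 1) = -1 := by
    have : ∀ c : K, (if c = 0 then (0 : K) else 1) = 1 - if c = 0 then 1 else 0 := fun c => by
      split_ifs <;> simp
    simp [this]
  rw [hline, Finset.sum_congr rfl fun c _ => by rw [hscale c, hpow c], ← Finset.sum_mul, hcount,
    eval_F, neg_one_mul, neg_eq_zero] at hsum
  exact mul_ne_zero (Finset.prod_ne_zero_iff.2 fun i _ => hfp i) (pow_ne_zero _ (hfp i₀)) hsum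

/-! ### Pairing elements of different colours -/

/-- A nonempty set of at most `2m` elements, coloured so that each colour occurs at most `m` times,
can be covered by `m` pairs whose entries are equal or have different colours. -/
theorem exists_cover_by_bicoloured_pairs {α β : Type*} [DecidableEq β] (T : Finset α)
    (hT : T.Nonempty) (c : α → β) (m : ℕ) (hcard : T.card ≤ 2 * m)
    (hc : ∀ b, (T.filter (c · = b)).card ≤ m) :
    ∃ x y : Fin m → α, (∀ i, x i ∈ T ∧ y i ∈ T ∧ (x i = y i ∨ c (x i) ≠ c (y i))) ∧
      ∀ t ∈ T, ∃ i, t = x i ∨ t = y i := by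
  classical
  obtain ⟨t₀, ht₀⟩ := hT
  let _ : LinearOrder β := linearOrderOfSTO WellOrderingRel
  let e := T.equivFin.symm
  let s := Tuple.sort fun i => c (e i)
  let t : Fin T.card → α := fun i => e (s i)
  have htT : ∀ i, t i ∈ T := fun i => (e (s i)).2
  have hinj : Function.Injective t :=
    Subtype.val_injective.comp (e.injective.comp s.injective)
  have hmono : Monotone (c ∘ t) := Tuple.monotone_sort fun i => c (e i)
  have hsurj : ∀ a ∈ T, ∃ i, t i = a := fun a ha =>
    ⟨s.symm (e.symm ⟨a, ha⟩), by simp [t]⟩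
  -- In the order sorted by colour, equal colours at i and i + m would give m + 1 elements of one
  -- colour.
  have hne : ∀ (i : ℕ) (h : i + m < T.card), c (t ⟨i, by omega⟩) ≠ c (t ⟨i + m, h⟩) := by
    intro i h heq
    refine (hc (c (t ⟨i, by omega⟩))).not_gt ?_
    have hsub : (Finset.Icc (⟨i, by omega⟩ : Fin T.card) ⟨i + m, h⟩).image t
        ⊆ T.filter (c · = c (t ⟨i, by omega⟩)) := by
      intro a ha
      obtain ⟨k, hk, rfl⟩ := Finset.mem_image.1 ha
      rw [Finset.mem_Icc] at hk
      exact Finset.mem_filter.2 ⟨htT k, le_antisymm (heq ▸ hmono hk.2) (hmono hk.1)⟩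
    have := Finset.card_le_card hsub
    rw [Finset.card_image_of_injective _ hinj, Fin.card_Icc] at this
    simp only at this
    omega
  refine ⟨fun i => if h : (i : ℕ) < T.card then t ⟨i, h⟩ else t₀,
    fun i => if h : (i : ℕ) + m < T.card then t ⟨i + m, h⟩ else
      if h : (i : ℕ) < T.card then t ⟨i, h⟩ else t₀, fun i => ⟨?_, ?_, ?_⟩, fun a ha => ?_⟩
  · dsimp only; split_ifs <;> simp [htT, ht₀]
  · dsimp only; split_ifs <;> simp [htT, ht₀]
  · dsimp only
    by_cases h : (i : ℕ) + m < T.card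
    · right
      rw [dif_pos h, dif_pos (by omega)]
      exact hne i h
    · left
      rw [dif_neg h]
  · obtain ⟨k, rfl⟩ := hsurj a ha
    by_cases hk : (k : ℕ) < m
    · exact ⟨⟨k, hk⟩, Or.inl (by simp)⟩
    · refine ⟨⟨k - m, by omega⟩, Or.inr ?_⟩
      have h : (k : ℕ) - m + m = k := by omega
      simp [h]

open Module

/-! ### Incidence of points and lines -/

section Lines

variable {K V : Type*} [Field K] [AddCommGroup V] [Module K V]

theorem finrank_sup_of_ne {P Q : ℙ K V} (h : P ≠ Q) :
    finrank K ↥(P.submodule ⊔ Q.submodule) = 2 := by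
  have hadd := Submodule.finrank_sup_add_finrank_inf_eq P.submodule Q.submodule
  rw [P.finrank_submodule, Q.finrank_submodule] at hadd
  have h0 : finrank K ↥(P.submodule ⊓ Q.submodule) = 0 := by
    by_contra h0
    refine h (Projectivization.submodule_injective ?_)
    have h1 := Submodule.eq_of_le_of_finrank_le (inf_le_left : P.submodule ⊓ Q.submodule ≤ _)
      (by rw [P.finrank_submodule]; omega)
    have h2 := Submodule.eq_of_le_of_finrank_le (inf_le_right : P.submodule ⊓ Q.submodule ≤ _)
      (by rw [Q.finrank_submodule]; omega)
    exact h1.symm.trans h2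
  omega

theorem sup_eq_of_ne {P Q : ℙ K V} (h : P ≠ Q) {M : Submodule K V} (hM : finrank K M = 2)
    (hP : P.submodule ≤ M) (hQ : Q.submodule ≤ M) : P.submodule ⊔ Q.submodule = M := by
  have : FiniteDimensional K M := FiniteDimensional.of_finrank_pos (by omega)
  exact Submodule.eq_of_le_of_finrank_eq (sup_le hP hQ) (by rw [hM, finrank_sup_of_ne h])

/-- If P were on the line XY, then PX and PY would both equal that line. -/
theorem not_le_sup {P X Y : ℙ K V} (hX : X ≠ P) (hY : Y ≠ P)
    (h : X = Y ∨ P.submodule ⊔ X.submodule ≠ P.submodule ⊔ Y.submodule) :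
    ¬ P.submodule ≤ X.submodule ⊔ Y.submodule := by
  intro hP
  rcases eq_or_ne X Y with rfl | hXY
  · rw [sup_idem] at hP
    refine hX (Projectivization.submodule_injective ?_)
    exact (Submodule.eq_of_le_of_finrank_eq hP
      (by rw [X.finrank_submodule, P.finrank_submodule])).symm
  · have hM := finrank_sup_of_ne hXY
    exact h.resolve_left hXY ((sup_eq_of_ne hX.symm hM hP le_sup_left).trans
      (sup_eq_of_ne hY.symm hM hP le_sup_right).symm)

theorem rep_mem_iff {P : ℙ K V} {M : Submodule K V} : P.rep ∈ M ↔ P.submodule ≤ M := by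
  rw [P.submodule_eq, Submodule.span_singleton_le_iff_mem]

theorem mem_iff_submodule_le {P : ℙ K V} {H : Projectivization.Subspace K V} :
    P ∈ H ↔ P.submodule ≤ H.submodule := by
  rw [← Submodule.mem_projectivization_iff_submodule_le, OrderIso.symm_apply_apply]

/-- The line joining `X` and `Y` consists of `X` and at most `|K|` further points. -/
theorem ncard_le_of_subset_line [Finite K] {X Y : ℙ K V} {A : Set (ℙ K V)}
    (hA : ∀ P ∈ A, P ≠ X ∧ P.submodule ≤ X.submodule ⊔ Y.submodule) : A.ncard ≤ Nat.card K := by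
  classical
  let g : K → ℙ K V := fun t =>
    if h : t • X.rep + Y.rep = 0 then X else Projectivization.mk K (t • X.rep + Y.rep) h
  have hsub : A ⊆ Set.range g := by
    intro P hP
    obtain ⟨hPX, hPL⟩ := hA P hP
    rw [← rep_mem_iff, X.submodule_eq, Y.submodule_eq, ← Submodule.span_union,
      Set.singleton_union, Submodule.mem_span_pair] at hPL
    obtain ⟨s, t, hst⟩ := hPL
    have ht : t ≠ 0 := by
      rintro rfl
      refine hPX ?_
      rw [← P.mk_rep, ← X.mk_rep, Projectivization.mk_eq_mk_iff']
      exact ⟨s, by simpa using hst⟩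
    have hv : (t⁻¹ * s) • X.rep + Y.rep = t⁻¹ • P.rep := by
      rw [← hst, smul_add, smul_smul, smul_smul, inv_mul_cancel₀ ht, one_smul]
    have hne : (t⁻¹ * s) • X.rep + Y.rep ≠ 0 := by
      rw [hv]
      exact smul_ne_zero (inv_ne_zero ht) P.rep_nonzero
    refine ⟨t⁻¹ * s, ?_⟩
    simp only [g, dif_neg hne]
    conv_rhs => rw [← P.mk_rep]
    rw [Projectivization.mk_eq_mk_iff']
    exact ⟨t⁻¹, hv.symm⟩
  calc A.ncard ≤ (Set.range g).ncard := Set.ncard_le_ncard hsub (Set.finite_range g)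
    _ ≤ Nat.card K := by
      rw [← Set.image_univ, ← Set.ncard_univ]
      exact Set.ncard_image_le Set.finite_univ

end Lines

/-! ### Holes of partial covers -/

variable {K : Type*} [Field K]

theorem mem_holes_iff {n : ℕ} {S : Set (Projectivization.Subspace K (Fin (n + 1) → K))}
    {P : PG n K} : P ∈ holes S ↔ ∀ H ∈ S, P ∉ H := by
  simp [holes, through, Set.eq_empty_iff_forall_notMem]

/-- If the holes other than `P` are covered by `m` subspaces avoiding `P`, then these subspaces
and the members of `S` together number more than `n (|K| - 1)`. -/
theorem lt_ncard_add_of_covers_other_holes [Finite K] {n m : ℕ}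
    {S : Set (Projectivization.Subspace K (Fin (n + 1) → K))} (hS : S.Finite) (hne : S.Nonempty)
    {P : PG n K} (hP : P ∈ holes S) (W : Fin m → Submodule K (Fin (n + 1) → K))
    (hPW : ∀ i, ¬ P.submodule ≤ W i)
    (hW : ∀ Q ∈ holes S, Q ≠ P → ∃ i, Q.submodule ≤ W i) :
    n * (Nat.card K - 1) < S.ncard + m := by
  have := Fintype.ofFinite K
  have := hS.fintype
  have := hne.to_subtype
  have key := lt_card_of_covers_off_span (ι := S ⊕ Fin m)
    (Sum.elim (fun H => H.1.submodule) W) P.rep ?_ ?_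
  · rwa [Fintype.card_fin, Nat.add_sub_cancel, Fintype.card_sum, Fintype.card_fin,
      ← Nat.card_eq_fintype_card, ← Nat.card_eq_fintype_card, Nat.card_coe_set_eq] at key
  · rintro (H | i)
    · rw [Sum.elim_inl, rep_mem_iff, ← mem_iff_submodule_le]
      exact mem_holes_iff.1 hP H H.2
    · rw [Sum.elim_inr, rep_mem_iff]
      exact hPW i
  · intro x hx
    have hx0 : x ≠ 0 := by
      rintro rfl
      exact hx (Submodule.zero_mem _)
    let Q : PG n K := Projectivization.mk K x hx0
    have hQP : Q ≠ P := by
      intro h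
      rw [← P.submodule_eq, ← h] at hx
      exact hx (Submodule.mem_span_singleton_self x)
    by_cases hQ : Q ∈ holes S
    · obtain ⟨i, hi⟩ := hW Q hQ hQP
      exact ⟨Sum.inr i, hi (Submodule.mem_span_singleton_self x)⟩
    · rw [mem_holes_iff] at hQ
      push Not at hQ
      obtain ⟨H, hH, hQH⟩ := hQ
      exact ⟨Sum.inl ⟨H, hH⟩, (Projectivization.Subspace.mem_submodule_iff H hx0).2 hQH⟩

/-- Through every hole of a small cover with few holes there is a line with many holes. -/
theorem exists_line_with_many_holes [Finite K] {a : ℕ} (ha : 3 * a + 3 ≤ Nat.card K)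
    {S : Set (Projectivization.Subspace K (Fin (2 + 1) → K))}
    (hS : IsPartialCover (Nat.card K + a) S) (hholes : (holes S).ncard ≤ Nat.card K + a)
    {P : PG 2 K} (hP : P ∈ holes S) :
    ∃ Q ∈ holes S, Q ≠ P ∧ Nat.card K ≤
      {R ∈ holes S | R.submodule ≤ P.submodule ⊔ Q.submodule}.ncard + a := by
  classical
  have hfin : (holes S).Finite := Set.toFinite _
  have hne : S.Nonempty := Set.nonempty_of_ncard_ne_zero (by rw [hS.ncard_eq]; omega)
  let T : Finset (PG 2 K) := hfin.toFinset.erase P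
  have hTmem : ∀ Q, Q ∈ T ↔ Q ≠ P ∧ Q ∈ holes S := fun Q => by simp [T]
  have hTcard : T.card + 1 = (holes S).ncard := by
    rw [Set.ncard_eq_toFinset_card _ hfin]
    exact Finset.card_erase_add_one (by simpa using hP)
  have hTne : T.Nonempty := by
    by_contra hT
    rw [Finset.not_nonempty_iff_eq_empty] at hT
    have := lt_ncard_add_of_covers_other_holes (m := 0) hS.finite hne hP Fin.elim0
      (fun i => i.elim0) fun Q hQ hQP => absurd ((hTmem Q).2 ⟨hQP, hQ⟩) (by simp [hT])
    rw [hS.ncard_eq] at this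
    omega
  let c : PG 2 K → Submodule K (Fin (2 + 1) → K) := fun Q => P.submodule ⊔ Q.submodule
  -- With m = q - a - 2, the total (q + a) + m is exactly 2(q - 1), and 3a + 3 ≤ q gives |T| ≤ 2m.
  obtain ⟨b, hb⟩ : ∃ b, Nat.card K - a - 2 < (T.filter (c · = b)).card := by
    by_contra! hc
    obtain ⟨x, y, hxy, hcov⟩ := exists_cover_by_bicoloured_pairs T hTne c
      (Nat.card K - a - 2) (by omega) hc
    have := lt_ncard_add_of_covers_other_holes hS.finite hne hP
      (fun i => (x i).submodule ⊔ (y i).submodule)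
      (fun i => not_le_sup ((hTmem _).1 (hxy i).1).1 ((hTmem _).1 (hxy i).2.1).1 (hxy i).2.2)
      fun Q hQ hQP => by
        obtain ⟨i, rfl | rfl⟩ := hcov Q ((hTmem Q).2 ⟨hQP, hQ⟩)
        exacts [⟨i, le_sup_left⟩, ⟨i, le_sup_right⟩]
    rw [hS.ncard_eq] at this
    omega
  obtain ⟨Q, hQ⟩ := Finset.card_pos.1 ((Nat.zero_le _).trans_lt hb)
  obtain ⟨hQT, hQb⟩ := Finset.mem_filter.1 hQ
  refine ⟨Q, ((hTmem Q).1 hQT).2, ((hTmem Q).1 hQT).1, ?_⟩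
  have hsub : (↑(insert P (T.filter (c · = b))) : Set (PG 2 K)) ⊆
      {R ∈ holes S | R.submodule ≤ P.submodule ⊔ Q.submodule} := by
    intro R hR
    rcases Finset.mem_insert.1 hR with rfl | hR
    · exact ⟨hP, le_sup_left⟩
    · obtain ⟨hRT, hRb⟩ := Finset.mem_filter.1 hR
      refine ⟨((hTmem R).1 hRT).2, ?_⟩
      have : c R = c Q := hRb.trans hQb.symm
      exact le_sup_right.trans this.le
  have hle := Set.ncard_le_ncard hsub (Set.toFinite _)
  rw [Set.ncard_coe_finset, Finset.card_insert_of_notMem (by simp [hTmem])] at hle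
  omega

theorem ncard_add_ncard_le_of_lines_ne {V : Type*} [AddCommGroup V] [Module K V]
    {A : Set (ℙ K V)} (hA : A.Finite) {L M : Submodule K V} (hL : finrank K L = 2)
    (hM : finrank K M = 2) (hLM : L ≠ M) :
    {R ∈ A | R.submodule ≤ L}.ncard + {R ∈ A | R.submodule ≤ M}.ncard ≤ A.ncard + 1 := by
  have hfL : {R ∈ A | R.submodule ≤ L}.Finite := hA.subset fun _ h => h.1
  have hfM : {R ∈ A | R.submodule ≤ M}.Finite := hA.subset fun _ h => h.1
  rw [← Set.ncard_union_add_ncard_inter _ _ hfL hfM]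
  refine Nat.add_le_add (Set.ncard_le_ncard (Set.union_subset (fun _ h => h.1) fun _ h => h.1) hA) ?_
  rw [Set.ncard_le_one (hfL.inter_of_left _)]
  intro R hR R' hR'
  by_contra hne
  exact hLM ((sup_eq_of_ne hne hL hR.1.2 hR'.1.2).symm.trans (sup_eq_of_ne hne hM hR.2.2 hR'.2.2))

end PartialCover

theorem theorem5 {K : Type*} [Field K] [Finite K] (q a : ℕ) (hK : Nat.card K = q)
    (hq : 13 < q) (ha : (a : ℝ) ≤ ((q : ℝ) - 10) / 4)
    (S : Set (Projectivization.Subspace K (Fin (2 + 1) → K)))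
    (hS : PartialCover.IsPartialCover (q + a) S)
    (hholes : (PartialCover.holes S).ncard ≤ q + a) :
    (PartialCover.holes S).ncard ≤ q ∧
      Projectivization.IsCollinear (PartialCover.holes S) := by
  subst hK
  have ha4 : 4 * a + 10 ≤ Nat.card K := by
    have : (4 * a + 10 : ℝ) ≤ Nat.card K := by linarith
    exact_mod_cast this
  obtain ⟨P, hP⟩ := hS.holes_nonempty
  obtain ⟨Q, hQ, hQP, hPQ⟩ :=
    PartialCover.exists_line_with_many_holes (by omega) hS hholes hP
  have hL := PartialCover.finrank_sup_of_ne hQP.symm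
  have hline : ∀ R ∈ PartialCover.holes S, R.submodule ≤ P.submodule ⊔ Q.submodule := by
    intro R hR
    obtain ⟨R', hR', hne, hRR'⟩ :=
      PartialCover.exists_line_with_many_holes (by omega) hS hholes hR
    by_contra hnot
    have hcount : ∀ u v : ℕ, Nat.card K ≤ u + a → Nat.card K ≤ v + a →
        ¬ u + v ≤ (PartialCover.holes S).ncard + 1 := by omega
    refine hcount _ _ hPQ hRR' <| PartialCover.ncard_add_ncard_le_of_lines_ne (Set.toFinite (PartialCover.holes S)) hL
      (PartialCover.finrank_sup_of_ne hne.symm) fun h => hnot (h ▸ le_sup_left)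
  refine ⟨?_, (P.submodule ⊔ Q.submodule).projectivization, inferInstance, ?_, fun R hR => ?_⟩
  -- H meets the line of holes in a covered point X, leaving at most q candidates.
  · obtain ⟨H, hH⟩ : S.Nonempty :=
      Set.nonempty_of_ncard_ne_zero (by rw [hS.ncard_eq]; omega)
    have hmeet : H.submodule ⊓ (P.submodule ⊔ Q.submodule) ≠ ⊥ := by
      intro h
      have hadd := Submodule.finrank_sup_add_finrank_inf_eq H.submodule
        (P.submodule ⊔ Q.submodule)
      have hle := Submodule.finrank_le (H.submodule ⊔ (P.submodule ⊔ Q.submodule))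
      have hH2 := hS.isHyperplane H hH
      rw [PartialCover.IsHyperplane] at hH2
      rw [h, finrank_bot, hH2, hL] at hadd
      rw [Module.finrank_fin_fun] at hle
      omega
    obtain ⟨x, ⟨hxH, hxL⟩, hx0⟩ := Submodule.exists_mem_ne_zero_of_ne_bot hmeet
    let X : PartialCover.PG 2 K := Projectivization.mk K x hx0
    have hXH : X ∈ H := (Projectivization.Subspace.mem_submodule_iff H hx0).1 hxH
    have hXP : X ≠ P := fun h => PartialCover.mem_holes_iff.1 hP H hH (h ▸ hXH)
    have hXL : X.submodule ≤ P.submodule ⊔ Q.submodule := by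
      rw [Projectivization.submodule_mk, Submodule.span_singleton_le_iff_mem]
      exact hxL
    refine PartialCover.ncard_le_of_subset_line (X := X) (Y := P) fun R hR => ⟨?_, ?_⟩
    · rintro rfl
      exact PartialCover.mem_holes_iff.1 hR H hH hXH
    · rw [PartialCover.sup_eq_of_ne hXP hL hXL le_sup_left]
      exact hline R hR
  · rw [OrderIso.apply_symm_apply, hL]
  · exact (Submodule.mem_projectivization_iff_submodule_le _ _).2 (hline R hR)
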